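/- Let $I$ be a set, let $\mathcal U$ be a free ultrafilter on $I$ (for instance $I=\mathbb N$), and let ${}^*\mathbb R=\mathbb R^I/\!\sim_{\mathcal U}$ be the corresponding field of non-standard real numbers, where $(a_j)\sim_{\mathcal U}(b_j)$ if $\{j\in I: a_j=b_j\}\in\mathcal U$, with its usual order. For a positive infinitesimal $\rho\in{}^*\mathbb R$ (that is, $0<\rho<1/n$ for all $n\in\mathbb N$, $n\ge 1$), let ${}^\rho\mathbb R=\mathcal M_\rho/\mathcal N_\rho$ be Robinson's field of asymptotic numbers, where $$\mathcal M_\rho=\{x\in{}^*\mathbb R: |x|\le\rho^{-n}\text{ for some } n\in\mathbb N\},\qquad \mathcal N_\rho=\{x\in{}^*\mathbb R: |x|<\rho^{n}\text{ for all } n\in\mathbb N\}.$$ For a field $R$ in which $-1$ is not a square, $R(i)$ denotes the field obtained by adjoining a root $i$ of $x^2+1$; put ${}^*\mathbb C={}^*\mathbb R(i)$ and ${}^\rho\mathbb C={}^\rho\mathbb R(i)$. Let $\mathfrak c=\operatorname{card}\mathbb R$. Then: 1. ${}^*\mathbb R$ is a real closed field, and ${}^\rho\mathbb R$ is a real closed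 field for every positive infinitesimal $\rho\in{}^*\mathbb R$. 2. If $I$ is countable (in particular, if $I=\mathbb N$), then $\operatorname{card}({}^*\mathbb R)=\mathfrak c$, and $\operatorname{card}({}^\rho\mathbb R)=\mathfrak c$ for every positive infinitesimal $\rho\in{}^*\mathbb R$. 3. If $\operatorname{card}({}^*\mathbb R)=\mathfrak c$, then $\mathbb C\cong{}^*\mathbb C$ as fields; and if moreover $\rho\in{}^*\mathbb R$ is a positive infinitesimal with $\operatorname{card}({}^\rho\mathbb R)=\mathfrak c$, then $$\mathbb C\cong{}^*\mathbb C\cong{}^\rho\mathbb C .$$ In particular, for $I=\mathbb N$ the isomorphisms $\mathbb C\cong{}^*\mathbb C\cong{}^\rho\mathbb C$ hold unconditionally. -/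

import Mathlib

noncomputable section

/-- `x` is infinitesimal: `|x| < 1/n` for every positive natural number `n`. -/
def IsInfinitesimal {K : Type*} [Field K] [LinearOrder K] (x : K) : Prop :=
  ∀ n : ℕ, 0 < n → |x| < 1 / (n : K)

/-- The positive infinitesimals of an ordered field. -/
abbrev PosInfinitesimal (K : Type*) [Field K] [LinearOrder K] : Type _ :=
  {ρ : K // 0 < ρ ∧ IsInfinitesimal ρ}

section Asymptotic

variable {K : Type*} [Field K] [LinearOrder K] [IsStrictOrderedRing K]

theorem PosInfinitesimal.lt_half (ρ : PosInfinitesimal K) : (ρ : K) < 1 / 2 := by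
  have h := ρ.2.2 2 (by norm_num)
  rw [abs_of_pos ρ.2.1] at h
  exact_mod_cast h

theorem PosInfinitesimal.inv_pow_mono (ρ : PosInfinitesimal K) {m n : ℕ} (h : m ≤ n) :
    ((ρ : K) ^ m)⁻¹ ≤ ((ρ : K) ^ n)⁻¹ := by
  have h1 := ρ.lt_half
  exact inv_anti₀ (pow_pos ρ.2.1 n)
    (pow_le_pow_of_le_one ρ.2.1.le (h1.le.trans (by norm_num)) h)

theorem PosInfinitesimal.two_mul_pow_le (ρ : PosInfinitesimal K) (n : ℕ) :
    2 * (ρ : K) ^ (n + 1) ≤ (ρ : K) ^ n := by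
  have h1 := ρ.lt_half
  have h2 := pow_pos ρ.2.1 n
  rw [pow_succ]
  nlinarith

/-- The ring `M_ρ` of the `x` with `|x| ≤ ρ⁻ⁿ` for some `n`. -/
def moderateSubring (ρ : PosInfinitesimal K) : Subring K where
  carrier := {x | ∃ n : ℕ, |x| ≤ ((ρ : K) ^ n)⁻¹}
  zero_mem' := ⟨0, by simp⟩
  one_mem' := ⟨0, by simp⟩
  neg_mem' := by
    rintro x ⟨n, hn⟩
    exact ⟨n, by rwa [abs_neg]⟩
  add_mem' := by
    rintro x y ⟨m, hm⟩ ⟨n, hn⟩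
    refine ⟨max m n + 1, ?_⟩
    have h1 := hm.trans (ρ.inv_pow_mono (le_max_left m n))
    have h2 := hn.trans (ρ.inv_pow_mono (le_max_right m n))
    have h3 := ρ.two_mul_pow_le (max m n)
    have h4 := pow_pos ρ.2.1 (max m n)
    have h5 := pow_pos ρ.2.1 (max m n + 1)
    have h6 : 2 * ((ρ : K) ^ max m n)⁻¹ ≤ ((ρ : K) ^ (max m n + 1))⁻¹ := by
      rw [← div_eq_mul_inv, div_le_iff₀ h4, inv_mul_eq_div, le_div_iff₀ h5]
      exact h3
    linarith [abs_add_le x y]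
  mul_mem' := by
    rintro x y ⟨m, hm⟩ ⟨n, hn⟩
    refine ⟨m + n, ?_⟩
    rw [abs_mul, pow_add, mul_inv]
    exact mul_le_mul hm hn (abs_nonneg y) (inv_nonneg.2 (pow_pos ρ.2.1 m).le)

/-- The set `N_ρ` of the `x` with `|x| < ρⁿ` for all `n`, as an ideal of `M_ρ`. -/
def negligibleIdeal (ρ : PosInfinitesimal K) : Ideal (moderateSubring ρ) where
  carrier := {x | ∀ n : ℕ, |(x : K)| < (ρ : K) ^ n}
  zero_mem' := fun n => by simpa using pow_pos ρ.2.1 n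
  add_mem' := by
    intro x y hx hy n
    have h1 := hx (n + 1)
    have h2 := hy (n + 1)
    have h3 := ρ.two_mul_pow_le n
    have h4 := abs_add_le (x : K) (y : K)
    push_cast
    linarith
  smul_mem' := by
    rintro ⟨c, m, hm⟩ x hx n
    have h1 := hx (m + n)
    have h2 := pow_pos ρ.2.1 m
    change |c * (x : K)| < _
    rw [abs_mul]
    calc |c| * |(x : K)| ≤ ((ρ : K) ^ m)⁻¹ * |(x : K)| :=
          mul_le_mul_of_nonneg_right hm (abs_nonneg _)
      _ < ((ρ : K) ^ m)⁻¹ * (ρ : K) ^ (m + n) :=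
          mul_lt_mul_of_pos_left h1 (inv_pos.2 h2)
      _ = (ρ : K) ^ n := by rw [pow_add, inv_mul_cancel_left₀ h2.ne']

/-- `N_ρ` is a maximal ideal of `M_ρ`, so that the quotient is a field. -/
instance negligibleIdeal_isMaximal (ρ : PosInfinitesimal K) :
    (negligibleIdeal ρ).IsMaximal := by
  rw [Ideal.isMaximal_iff]
  refine ⟨fun h => by simpa using h 0, ?_⟩
  intro J x _ hx hxJ
  obtain ⟨n, hn⟩ : ∃ n : ℕ, (ρ : K) ^ n ≤ |(x : K)| := by
    by_contra hc
    push Not at hc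
    exact hx hc
  have h0 := pow_pos ρ.2.1 n
  have hx0 : (x : K) ≠ 0 := abs_pos.1 (h0.trans_le hn)
  have hi : (x : K)⁻¹ ∈ moderateSubring ρ :=
    ⟨n, by rw [abs_inv]; exact inv_anti₀ h0 hn⟩
  have h1 : (⟨(x : K)⁻¹, hi⟩ : moderateSubring ρ) * x = 1 :=
    Subtype.ext (inv_mul_cancel₀ hx0)
  exact h1 ▸ J.mul_mem_left _ hxJ

/-- Robinson's field of asymptotic numbers `M_ρ / N_ρ`. -/
abbrev AsymptoticField (ρ : PosInfinitesimal K) : Type _ :=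
  moderateSubring ρ ⧸ negligibleIdeal ρ

instance AsymptoticField.instField (ρ : PosInfinitesimal K) : Field (AsymptoticField ρ) :=
  Ideal.Quotient.field (negligibleIdeal ρ)

end Asymptotic

/-- The non-standard real numbers `*ℝ = ℝ^I / ∼_U`: two families of real numbers are identified
when they agree on a set of `U`. -/
abbrev StarReal {I : Type*} (U : Ultrafilter I) : Type _ :=
  Filter.Germ (U : Filter I) ℝ

/-- `R(i)`: the expressions `x + y i` with `x y : R`, multiplied according to `i² = -1`. -/
abbrev AdjoinI (R : Type*) [CommRing R] : Type _ :=
  QuadraticAlgebra R (-1) 0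

end

noncomputable section

open Polynomial

/-! The property "every monic polynomial of degree n has a root" passes to powers, by choosing roots
coordinatewise, and to quotients, by lifting a monic polynomial to a monic one of the same degree.
So `*ℝ` inherits odd-degree roots from `ℝ^I`, and `*ℝ(i)` is algebraically closed as a quotient of
`ℂ^I`. For the asymptotic numbers, `M_ρ` is a valuation ring of `*ℝ`, hence integrally closed: roots
in `*ℝ` of monic polynomials over `M_ρ` are moderate, and a norm argument gives the same for
`M_ρ(i)` in `*ℝ(i)`. Reduction modulo `N_ρ` then yields the roots. The isomorphisms follow from
Steinitz: characteristic zero and cardinality `𝔠` determine an algebraically closed field. -/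

/-- A surjective ring homomorphism transfers the existence of roots of monic polynomials of a
given degree. -/
theorem exists_isRoot_of_monic_of_surjective {A B : Type*} [CommRing A] [CommRing B]
    {φ : A →+* B} (hφ : Function.Surjective φ) {n : ℕ}
    (h : ∀ p : A[X], p.Monic → p.natDegree = n → ∃ x, p.IsRoot x)
    {q : B[X]} (hq : q.Monic) (hn : q.natDegree = n) : ∃ x, q.IsRoot x := by
  obtain ⟨p, rfl, hp, hp'⟩ := lifts_and_natDegree_eq_and_monic
    ((lifts_iff_coeff_lifts q).2 fun k => hφ (q.coeff k)) hq
  obtain ⟨x, hx⟩ := h p hp' (hp.trans hn)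
  exact ⟨φ x, hx.map⟩

/-- In a power of `R`, monic polynomials of a given degree have roots if they do in `R`. -/
theorem exists_isRoot_of_monic_pi {I R : Type*} [CommRing R] [Nontrivial R] {n : ℕ}
    (h : ∀ p : R[X], p.Monic → p.natDegree = n → ∃ x, p.IsRoot x)
    (p : (I → R)[X]) (hp : p.Monic) (hn : p.natDegree = n) : ∃ x, p.IsRoot x := by
  choose x hx using fun j => h (p.map (Pi.evalRingHom (fun _ : I => R) j)) (hp.map _)
    ((hp.natDegree_map _).trans hn)
  refine ⟨x, funext fun j => ?_⟩
  have := hx j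
  rw [IsRoot.def, eval_map] at this
  change Pi.evalRingHom (fun _ : I => R) j (p.eval x) = 0
  rwa [← eval₂_hom]

/-- A monic real polynomial of odd degree has a real root. -/
theorem Real.exists_isRoot_of_monic_of_odd {p : ℝ[X]} (hp : p.Monic) (hn : Odd p.natDegree) :
    ∃ x, p.IsRoot x := by
  have hpos : 0 < p.natDegree := hn.pos
  have h1 : Filter.Tendsto (fun x => p.eval x) Filter.atTop Filter.atTop :=
    p.tendsto_atTop_of_leadingCoeff_nonneg (natDegree_pos_iff_degree_pos.1 hpos)
      (by simp [hp.leadingCoeff])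
  -- In odd degree, `p(-X)` has leading coefficient `-1`, so `p` takes values of both signs.
  have hdeg : (p.comp (-X)).natDegree = p.natDegree := by simp [natDegree_comp]
  have h2 : Filter.Tendsto (fun x => (p.comp (-X)).eval x) Filter.atTop Filter.atBot := by
    refine tendsto_atBot_of_leadingCoeff_nonpos _
      (natDegree_pos_iff_degree_pos.1 (hdeg ▸ hpos)) ?_
    rw [leadingCoeff_comp (by simp)]
    simp [hp.leadingCoeff, hn.neg_one_pow]
  obtain ⟨a, ha⟩ := (h1.eventually_ge_atTop 0).exists
  obtain ⟨b, hb⟩ := (h2.eventually_le_atBot 0).exists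
  exact mem_range_of_exists_le_of_exists_ge p.continuous
    ⟨-b, by simpa using hb⟩ ⟨a, ha⟩

/-- To find roots of odd degree polynomials over a field it suffices to do so for monic ones. -/
theorem exists_isRoot_of_odd_of_monic {F : Type*} [Field F]
    (h : ∀ p : F[X], p.Monic → Odd p.natDegree → ∃ x, p.IsRoot x)
    {f : F[X]} (hf : Odd f.natDegree) : ∃ x, f.IsRoot x := by
  have h0 : f ≠ 0 := by
    rintro rfl
    simp at hf
  obtain ⟨x, hx⟩ := h _ (monic_mul_leadingCoeff_inv h0)
    (by rwa [natDegree_mul_leadingCoeff_inv f h0])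
  exact ⟨x, by simpa [IsRoot.def, h0] using hx⟩

/-! ### Adjoining a square root of -1 -/

namespace AdjoinI

/-- The ring homomorphism `R(i) → S(i)` induced by a ring homomorphism `R → S`. -/
def map {R S : Type*} [CommRing R] [CommRing S] (f : R →+* S) : AdjoinI R →+* AdjoinI S where
  toFun z := ⟨f z.re, f z.im⟩
  map_zero' := by ext <;> simp
  map_one' := by ext <;> simp [QuadraticAlgebra.re_one, QuadraticAlgebra.im_one]
  map_add' z w := by ext <;> simp
  map_mul' z w := by ext <;> simp

theorem map_surjective {R S : Type*} [CommRing R] [CommRing S] {f : R →+* S}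
    (hf : Function.Surjective f) : Function.Surjective (map f) := by
  rintro ⟨x, y⟩
  obtain ⟨a, rfl⟩ := hf x
  obtain ⟨b, rfl⟩ := hf y
  exact ⟨⟨a, b⟩, rfl⟩

/-- This is the form of "-1 is not a square" from which `QuadraticAlgebra` gets its field structure.
-/
instance fact_sq_ne {F : Type*} [Field F] [IsSemireal F] : Fact (∀ r : F, r ^ 2 ≠ -1 + 0 * r) :=
  ⟨fun r hr => IsSemireal.not_isSumSq_neg_one F (by
    rw [zero_mul, add_zero] at hr
    exact hr ▸ (sq r ▸ IsSumSq.mul_self r))⟩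

theorem isAlgClosed {F : Type*} [Field F] [IsSemireal F]
    (h : ∀ p : (AdjoinI F)[X], p.Monic → p.natDegree ≠ 0 → ∃ x, p.IsRoot x) :
    IsAlgClosed (AdjoinI F) :=
  IsAlgClosed.of_exists_root _ fun p hp hi => h p hp hi.natDegree_pos.ne'

theorem mk_eq {R : Type*} [CommRing R] (h : Cardinal.mk R = Cardinal.continuum) :
    Cardinal.mk (AdjoinI R) = Cardinal.continuum := by
  rw [Cardinal.mk_congr (QuadraticAlgebra.equivProd (-1 : R) 0)]
  simp [h]

end AdjoinI

/-! ### The ultrapower of the reals -/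

namespace StarReal

variable {I : Type*} (U : Ultrafilter I)

theorem coeRingHom_surjective :
    Function.Surjective (Filter.Germ.coeRingHom (R := ℝ) (U : Filter I)) :=
  Quotient.mk_surjective

instance isRealClosed : IsRealClosed (StarReal U) := by
  refine .of_linearOrderedField (fun {x} => ?_) fun {f} =>
    exists_isRoot_of_odd_of_monic fun p hp hn => ?_
  · refine Filter.Germ.inductionOn x fun f hf => ?_
    refine ⟨((fun j => √(f j) : I → ℝ) : StarReal U), ?_⟩
    rw [← Filter.Germ.coe_mul]
    refine Filter.Germ.coe_eq.2 ?_
    filter_upwards [Filter.Germ.coe_le.1 hf] with j hj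
    exact (Real.mul_self_sqrt hj).symm
  · exact exists_isRoot_of_monic_of_surjective (coeRingHom_surjective U)
      (exists_isRoot_of_monic_pi fun q hq hqn =>
        Real.exists_isRoot_of_monic_of_odd hq (hqn ▸ hn)) hp rfl

/-- The map sending a family of complex numbers to its class in `*ℝ(i)`. -/
def complexFamilies : (I → ℂ) →+* AdjoinI (StarReal U) where
  toFun f := ⟨((fun j => (f j).re : I → ℝ) : StarReal U),
    ((fun j => (f j).im : I → ℝ) : StarReal U)⟩
  map_zero' := rfl
  map_one' := rfl
  map_add' _ _ := rfl
  map_mul' f g := by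
    ext
    · simp only [QuadraticAlgebra.re_mul, Pi.mul_apply, Complex.mul_re, neg_one_mul]
      rw [neg_mul, ← sub_eq_add_neg]
      rfl
    · simp only [QuadraticAlgebra.im_mul, Pi.mul_apply, Complex.mul_im, zero_mul, add_zero]
      rfl

theorem complexFamilies_surjective : Function.Surjective (complexFamilies U) := by
  rintro ⟨x, y⟩
  obtain ⟨a, rfl⟩ := coeRingHom_surjective U x
  obtain ⟨b, rfl⟩ := coeRingHom_surjective U y
  exact ⟨fun j => ⟨a j, b j⟩, rfl⟩

instance isAlgClosed_adjoinI : IsAlgClosed (AdjoinI (StarReal U)) :=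
  AdjoinI.isAlgClosed fun _ hp hn =>
    exists_isRoot_of_monic_of_surjective (complexFamilies_surjective U)
      (exists_isRoot_of_monic_pi fun q _ hqn => IsAlgClosed.exists_root q fun h =>
        hn (hqn ▸ natDegree_eq_of_degree_eq_some h)) hp rfl

theorem mk_le_continuum [Countable I] : Cardinal.mk (StarReal U) ≤ Cardinal.continuum := by
  have h := Cardinal.mk_le_of_surjective (coeRingHom_surjective U)
  refine h.trans ?_
  simp only [Cardinal.mk_pi, Cardinal.prod_const, Cardinal.mk_real, Cardinal.lift_continuum]
  -- Countability of `I` bounds the power by `𝔠 ^ ℵ₀ = 𝔠`.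
  refine (Cardinal.power_le_power_left Cardinal.continuum_ne_zero
    (Cardinal.lift_le_aleph0.2 (Cardinal.mk_le_aleph0 (α := I)))).trans ?_
  simp

end StarReal

/-- A field of cardinality at most the continuum into which `ℝ` maps has cardinality
`continuum`. -/
theorem mk_eq_continuum_of_ringHom {F : Type*} [Field F] (f : ℝ →+* F)
    (h : Cardinal.mk F ≤ Cardinal.continuum) : Cardinal.mk F = Cardinal.continuum :=
  h.antisymm (by
    simpa [Cardinal.mk_real] using Cardinal.lift_mk_le_lift_mk_of_injective f.injective)

/-! ### Integral closedness of the moderate elements -/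

section Moderate

variable {K : Type*} [Field K] [LinearOrder K] [IsStrictOrderedRing K] (ρ : PosInfinitesimal K)

theorem mem_moderateSubring_of_abs_le {x y : K} (hy : y ∈ moderateSubring ρ) (h : |x| ≤ |y|) :
    x ∈ moderateSubring ρ := by
  obtain ⟨n, hn⟩ := hy
  exact ⟨n, h.trans hn⟩

/-- The ring of moderate elements as a valuation ring. -/
def moderateValuationSubring : ValuationSubring K where
  __ := moderateSubring ρ
  mem_or_inv_mem' x := by
    have h1 : (1 : K) ∈ moderateSubring ρ := one_mem _
    rcases le_total |x| 1 with h | h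
    · exact .inl (mem_moderateSubring_of_abs_le ρ h1 (by simpa using h))
    · refine .inr (mem_moderateSubring_of_abs_le ρ h1 ?_)
      rw [abs_inv, abs_one]
      exact inv_le_one_of_one_le₀ h

theorem mem_moderateSubring_of_isIntegral {x : K} (hx : IsIntegral (moderateSubring ρ) x) :
    x ∈ moderateSubring ρ := by
  obtain ⟨y, rfl⟩ := (IsIntegrallyClosed.isIntegral_iff
    (R := moderateValuationSubring ρ) (K := K)).1 hx
  exact y.2

theorem natCast_le_inv (n : ℕ) : (n : K) ≤ (ρ : K)⁻¹ := by
  rcases n.eq_zero_or_pos with rfl | hn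
  · simpa using ρ.2.1.le
  · have h := ρ.2.2 n hn
    rw [abs_of_pos ρ.2.1, one_div] at h
    exact (le_inv_comm₀ ρ.2.1 (by exact_mod_cast hn)).1 h.le

theorem isSquare_moderateSubring_of_nonneg [IsRealClosed K] {x : moderateSubring ρ}
    (hx : 0 ≤ (x : K)) : IsSquare x := by
  obtain ⟨y, hy⟩ := IsSquare.of_nonneg hx
  have hm : y ∈ moderateSubring ρ := by
    -- The root is moderate because `|y| ≤ 1 + y²`.
    refine mem_moderateSubring_of_abs_le ρ (y := 1 + x) (add_mem (one_mem _) x.2) ?_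
    rw [abs_of_nonneg (by positivity : 0 ≤ 1 + (x : K)), hy]
    exact abs_le.2 ⟨by nlinarith [sq_nonneg (y + 1)], by nlinarith [sq_nonneg (y - 1)]⟩
  exact ⟨⟨y, hm⟩, Subtype.ext hy⟩

/-- A monic polynomial with moderate coefficients of odd degree has a moderate root. -/
theorem exists_isRoot_moderateSubring_of_odd [IsRealClosed K] {p : (moderateSubring ρ)[X]}
    (hp : p.Monic) (hn : Odd p.natDegree) : ∃ x, p.IsRoot x := by
  obtain ⟨x, hx⟩ := IsRealClosed.exists_isRoot_of_odd_natDegree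
    (f := p.map (algebraMap (moderateSubring ρ) K)) (by rwa [hp.natDegree_map])
  rw [IsRoot.def, eval_map] at hx
  refine ⟨⟨x, mem_moderateSubring_of_isIntegral ρ ⟨p, hp, hx⟩⟩, Subtype.ext ?_⟩
  exact (eval₂_hom (algebraMap (moderateSubring ρ) K) _).symm.trans hx

/-- The conjugate of `z` is integral too, hence so is the norm `re² + im²`. The norm is therefore
moderate, and `1 + re² + im²` dominates both `|re|` and `|im|`. -/
theorem mem_moderateSubring_of_isIntegral_adjoinI {z : AdjoinI K}
    (hz : IsIntegral (moderateSubring ρ) z) :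
    z.re ∈ moderateSubring ρ ∧ z.im ∈ moderateSubring ρ := by
  have hs : IsIntegral (moderateSubring ρ) (star z) :=
    hz.map_of_comp_eq (RingHom.id _) (starRingEnd (AdjoinI K)) (by
      ext x <;> simp [starRingEnd_apply, QuadraticAlgebra.algebraMap_eq,
        IsScalarTower.algebraMap_apply (moderateSubring ρ) K (AdjoinI K)])
  have hN : z * star z = algebraMap K (AdjoinI K) (z.re ^ 2 + z.im ^ 2) := by
    rw [QuadraticAlgebra.algebraMap_eq]
    ext <;> simp <;> ring
  have hm : z.re ^ 2 + z.im ^ 2 ∈ moderateSubring ρ := by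
    refine mem_moderateSubring_of_isIntegral ρ ?_
    rw [← isIntegral_algebraMap_iff
      (QuadraticAlgebra.algebraMap_injective (a := (-1 : K)) (b := 0)), ← hN]
    exact hz.mul hs
  have hm' := add_mem (one_mem _) hm
  have h0 : 0 ≤ 1 + (z.re ^ 2 + z.im ^ 2) := by positivity
  constructor <;> refine mem_moderateSubring_of_abs_le ρ hm' ?_ <;>
    rw [abs_of_nonneg h0, abs_le] <;>
    constructor <;>
    nlinarith [sq_nonneg (z.re + 1), sq_nonneg (z.re - 1), sq_nonneg (z.im + 1),
      sq_nonneg (z.im - 1)]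

/-- If `K(i)` is algebraically closed, then monic polynomials over `M_ρ(i)` have roots there. -/
theorem exists_isRoot_adjoinI_moderateSubring [IsSemireal K] [IsAlgClosed (AdjoinI K)]
    {p : (AdjoinI (moderateSubring ρ))[X]} (hp : p.Monic) (hn : p.natDegree ≠ 0) :
    ∃ z, p.IsRoot z := by
  let j : AdjoinI (moderateSubring ρ) →+* AdjoinI K := AdjoinI.map (moderateSubring ρ).subtype
  have hj : Function.Injective j := fun z w h => QuadraticAlgebra.ext
    (Subtype.ext (congrArg QuadraticAlgebra.re h)) (Subtype.ext (congrArg QuadraticAlgebra.im h))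
  obtain ⟨z, hz⟩ := IsAlgClosed.exists_root (p.map j) (by
    rw [hp.degree_map]
    exact fun h => hn (natDegree_eq_of_degree_eq_some h))
  rw [IsRoot.def, eval_map] at hz
  algebraize [j]
  have : IsScalarTower (moderateSubring ρ) (AdjoinI (moderateSubring ρ)) (AdjoinI K) :=
    .of_algebraMap_eq fun _ => rfl
  -- `z` is integral over `M_ρ(i)`, which is itself integral over `M_ρ`.
  have hi : IsIntegral (moderateSubring ρ) z :=
    isIntegral_trans (A := AdjoinI (moderateSubring ρ)) z ⟨p, hp, hz⟩
  obtain ⟨h1, h2⟩ := mem_moderateSubring_of_isIntegral_adjoinI ρ hi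
  refine ⟨⟨⟨z.re, h1⟩, ⟨z.im, h2⟩⟩, hj ?_⟩
  rw [← eval₂_hom, map_zero]
  exact hz

end Moderate

/-! ### The field of asymptotic numbers -/

namespace AsymptoticField

variable {K : Type*} [Field K] [LinearOrder K] [IsStrictOrderedRing K] (ρ : PosInfinitesimal K)

/-- This replaces an order on the quotient: positivity is checked on representatives in `K`. -/
theorem exists_nonneg_of_isSumSq {s : AsymptoticField ρ} (hs : IsSumSq s) :
    ∃ t : moderateSubring ρ, 0 ≤ (t : K) ∧ Ideal.Quotient.mk (negligibleIdeal ρ) t = s := by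
  induction hs with
  | zero => exact ⟨0, le_rfl, map_zero _⟩
  | sq_add a _ ih =>
    obtain ⟨t, ht, rfl⟩ := ih
    obtain ⟨b, rfl⟩ := Ideal.Quotient.mk_surjective a
    exact ⟨b * b + t, add_nonneg (mul_self_nonneg (b : K)) ht, by simp⟩

instance isSemireal : IsSemireal (AsymptoticField ρ) where
  one_add_ne_zero {s} hs h := by
    obtain ⟨t, ht, rfl⟩ := exists_nonneg_of_isSumSq ρ hs
    rw [← map_one (Ideal.Quotient.mk _), ← map_add, Ideal.Quotient.eq_zero_iff_mem] at h
    -- The exponent 0 suffices: negligible elements have absolute value below 1.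
    have h1 : |1 + (t : K)| < (ρ : K) ^ 0 := h 0
    rw [abs_of_nonneg (by positivity), pow_zero] at h1
    linarith

instance isRealClosed [IsRealClosed K] : IsRealClosed (AsymptoticField ρ) where
  isSquare_or_isSquare_neg x := by
    obtain ⟨a, rfl⟩ := Ideal.Quotient.mk_surjective x
    rcases le_total 0 (a : K) with h | h
    · exact .inl ((isSquare_moderateSubring_of_nonneg ρ h).map _)
    · rw [← map_neg]
      exact .inr ((isSquare_moderateSubring_of_nonneg ρ (x := -a) (by simpa using h)).map _)
  exists_isRoot_of_odd_natDegree := exists_isRoot_of_odd_of_monic fun _ hp hn =>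
    exists_isRoot_of_monic_of_surjective (Ideal.Quotient.mk_surjective (I := negligibleIdeal ρ))
      (fun _ hq hqn => exists_isRoot_moderateSubring_of_odd ρ hq (hqn ▸ hn)) hp rfl

instance isAlgClosed_adjoinI [IsSemireal K] [IsAlgClosed (AdjoinI K)] :
    IsAlgClosed (AdjoinI (AsymptoticField ρ)) :=
  AdjoinI.isAlgClosed fun _ hp hn => exists_isRoot_of_monic_of_surjective
    (AdjoinI.map_surjective (Ideal.Quotient.mk_surjective (I := negligibleIdeal ρ)))
    (fun _ hq hqn => exists_isRoot_adjoinI_moderateSubring ρ hq (hqn ▸ hn)) hp rfl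

theorem mk_le : Cardinal.mk (AsymptoticField ρ) ≤ Cardinal.mk K :=
  (Cardinal.mk_le_of_surjective Ideal.Quotient.mk_surjective).trans
    (Cardinal.mk_le_of_injective Subtype.val_injective)

end AsymptoticField

/-- The real constants as moderate elements of `*ℝ`. -/
def realToModerate {I : Type*} {U : Ultrafilter I} (ρ : PosInfinitesimal (StarReal U)) :
    ℝ →+* moderateSubring ρ :=
  ((Filter.Germ.coeRingHom (U : Filter I)).comp (Pi.constRingHom I ℝ)).codRestrict _ fun r => by
    obtain ⟨n, hn⟩ := exists_nat_ge |r|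
    -- Exponent 1 works for every real constant, since `ρ⁻¹` exceeds all natural numbers.
    refine ⟨1, ?_⟩
    rw [pow_one]
    refine le_trans ?_ (natCast_le_inv ρ n)
    change |((r : ℝ) : StarReal U)| ≤ ((n : ℝ) : StarReal U)
    rw [← Filter.Germ.const_abs]
    exact Filter.Germ.const_le hn

/-- Algebraically closed fields of characteristic zero with the cardinality of the continuum are
isomorphic. -/
theorem nonempty_ringEquiv_of_mk_eq_continuum {F L : Type*} [Field F] [Field L] [IsAlgClosed F]
    [IsAlgClosed L] [CharZero F] [CharZero L] (hF : Cardinal.mk F = Cardinal.continuum)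
    (hL : Cardinal.mk L = Cardinal.continuum) : Nonempty (F ≃+* L) :=
  IsAlgClosed.ringEquiv_of_equiv_of_charZero (hF ▸ Cardinal.aleph0_lt_continuum)
    (Cardinal.lift_mk_eq'.1 (by simp [hF, hL]))

end

theorem mainTheorem4 {I : Type*} (U : Ultrafilter I) (hU : (U : Filter I) ≤ Filter.cofinite) :
    IsRealClosed (StarReal U) ∧
    (∀ ρ : PosInfinitesimal (StarReal U), IsRealClosed (AsymptoticField ρ)) ∧
    (Countable I →
      Cardinal.mk (StarReal U) = Cardinal.continuum ∧
      ∀ ρ : PosInfinitesimal (StarReal U),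
        Cardinal.mk (AsymptoticField ρ) = Cardinal.continuum) ∧
    (Cardinal.mk (StarReal U) = Cardinal.continuum →
      Nonempty (ℂ ≃+* AdjoinI (StarReal U)) ∧
      ∀ ρ : PosInfinitesimal (StarReal U),
        Cardinal.mk (AsymptoticField ρ) = Cardinal.continuum →
          Nonempty (AdjoinI (StarReal U) ≃+* AdjoinI (AsymptoticField ρ))) := by
  refine ⟨inferInstance, fun ρ => inferInstance, fun _ => ⟨?_, fun ρ => ?_⟩, fun h => ⟨?_, ?_⟩⟩
  · exact mk_eq_continuum_of_ringHom ((Filter.Germ.coeRingHom _).comp (Pi.constRingHom I ℝ))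
      (StarReal.mk_le_continuum U)
  · exact mk_eq_continuum_of_ringHom ((Ideal.Quotient.mk _).comp (realToModerate ρ))
      ((AsymptoticField.mk_le ρ).trans (StarReal.mk_le_continuum U))
  · exact nonempty_ringEquiv_of_mk_eq_continuum Cardinal.mk_complex (AdjoinI.mk_eq h)
  · exact fun ρ hρ => nonempty_ringEquiv_of_mk_eq_continuum (AdjoinI.mk_eq h) (AdjoinI.mk_eq hρ)
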